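/- **Setting.** Let $X$ be a separable real Banach space with dual $X^*$ and duality $\langle x,x^*\rangle=x^*(x)$. Let $Q:X^*\to X$ be bounded, linear, symmetric ($\langle Qx^*,y^*\rangle=\langle Qy^*,x^*\rangle$) and non-negative ($\langle Qx^*,x^*\rangle\ge 0$), and let $A:D(A)\subseteq X\to X$ generate a strongly continuous contraction semigroup $(e^{tA})_{t\ge0}$ on $X$. Put $Q_tx^*=\int_0^te^{sA}Qe^{sA^*}x^*\,ds$. Assume that 1. for every $t>0$, $Q_t$ is the covariance operator of a centred Gaussian measure on $X$; 2. for every $x^*\in X^*$ the weak limit $Q_\infty x^*=\lim_{t\to\infty}Q_tx^*$ exists, and $Q_\infty$ is the covariance operator of a centred Gaussian measure $\mu_\infty$ on $X$ that is non-degenerate, i.e. $Q_\infty x^*=0$ implies $x^*=0$. For a bounded symmetric non-negative $F:X^*\to X$, its reproducing kernel Hilbert space is the completion of $FX^*$ for $[Fx^*,Fy^*]=\langle Fx^*,y^*\rangle$, which embeds continuously in $X$. Let $H$ and $H_\infty$ be those of $Q$ and $Q_\infty$, with embeddings $i,i_\infty$ into $X$ and adjoints $i^*:X^*\to H$, $i_\infty^*:X^*\to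 H_\infty$, so that $Q=ii^*$, $Q_\infty=i_\infty i_\infty^*$. Assume moreover that 3. there is $c>0$ such that for all $x^*\in D(A^*)$ one has $i_\infty^*A^*x^*\in H$ (as vectors of $X$) and $|i_\infty^*A^*x^*|_H\le c\,|i^*x^*|_H$. **The basis.** Let $\Theta=\{e_1,e_2,\dots\}$ be an orthonormal basis of $H_\infty$ (infinite if $\dim X=\infty$, finite otherwise) of the form $e_n=i_\infty^*f_n^*$ with $f_n^*\in D(A^*)$, where the $f_n^*$ are linearly independent and there is a weak-star dense sequence $(g_n^*)$ in $X^*$ each of whose elements is a (finite) linear combination of the $f_n^*$. **Functions and Sobolev spaces.** For $k\in\mathbb N$ let $C_b^k(\mathbb R^n)$ be the real functions with continuous and bounded derivatives up to order $k$. Let $\mathscr{FC}_b^k(X)$ be the set of functions $u(x)=\varphi(\langle x,x_1^*\rangle,\dots,\langle x,x_n^*\rangle)$ with $n\in\mathbb N$, $\varphi\in C_b^k(\mathbb R^n)$, $x_1^*,\dots,x_n^*\in X^*$, and let $\mathscr{FC}_{b,\Theta}^k(X)$ be the subset of those $u(x)=\varphi(\langle x,f_1^*\rangle,\dots,\langle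 x,f_m^*\rangle)$ with $m\in\mathbb N$, $\varphi\in C_b^k(\mathbb R^m)$. For such $u$ and $1\le j\le k$, $$D_H^ju(x)=\sum_{l_1,\dots,l_j=1}^n\frac{\partial^j\varphi}{\partial\xi_{l_1}\cdots\partial\xi_{l_j}}(\langle x,x_1^*\rangle,\dots,\langle x,x_n^*\rangle)\;i^*x_{l_1}^*\otimes\cdots\otimes i^*x_{l_j}^*,$$ a Hilbert–Schmidt $j$-linear form on $H$; the space of these, with the Hilbert–Schmidt norm, is denoted $\mathcal H_j$ (so $\mathcal H_1=H$, and $\mathcal H_2$ is the space of Hilbert–Schmidt operators on $H$). For $p\in(1,\infty)$, $W^{k,p}_H(X,\mu_\infty)$ is the domain of the closure in $L^p(X,\mu_\infty)$ of $$(D_H,\dots,D_H^k):\mathscr{FC}_b^k(X)\to\prod_{j=1}^kL^p(X,\mu_\infty;\mathcal H_j),$$ with the norm given by $\|u\|^p=\|u\|_{L^p(X,\mu_\infty)}^p+\sum_{j=1}^k\|D_H^ju\|_{L^p(X,\mu_\infty;\mathcal H_j)}^p$; a function $u$ of this space is identified with the point $(u,D_Hu,\dots,D_H^ku)$ of the graph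 of the closure. **Proposition.** For every $k\in\mathbb N$ and every $p\in(1,\infty)$, the space $\mathscr{FC}_{b,\Theta}^k(X)$ is dense in $W^{k,p}_H(X,\mu_\infty)$. -/

import Mathlib

open MeasureTheory ProbabilityTheory Filter Topology Set
open scoped NNReal ENNReal

noncomputable section

/-! ### Non-negative symmetric operators and their reproducing kernel Hilbert spaces -/

/-- A bounded linear operator `F : X* → X` that is symmetric, `⟨F x*, y*⟩ = ⟨F y*, x*⟩`, and
non-negative, `⟨F x*, x*⟩ ≥ 0`. -/
structure CovOp (X : Type*) [NormedAddCommGroup X] [NormedSpace ℝ X] where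
  /-- the underlying operator -/
  op : StrongDual ℝ X →L[ℝ] X
  symm' : ∀ x y : StrongDual ℝ X, y (op x) = x (op y)
  nonneg' : ∀ x : StrongDual ℝ X, 0 ≤ x (op x)

section RKHilbert

variable {X : Type*} [NormedAddCommGroup X] [NormedSpace ℝ X]

/-- The dual `X*`, to be endowed with the semi-inner product `⟨F x*, y*⟩`. Dividing out the vectors
of seminorm zero gives `F X*` with the inner product `[F x*, F y*] = ⟨F x*, y*⟩`. -/
def PreRKHS (_F : CovOp X) : Type _ := StrongDual ℝ X

namespace PreRKHS

variable (F : CovOp X)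

instance : AddCommGroup (PreRKHS F) := inferInstanceAs (AddCommGroup (StrongDual ℝ X))

instance : Module ℝ (PreRKHS F) := inferInstanceAs (Module ℝ (StrongDual ℝ X))

/-- The identity map `X* → PreRKHS F`. -/
def mk : StrongDual ℝ X ≃ₗ[ℝ] PreRKHS F := LinearEquiv.refl ℝ (StrongDual ℝ X)

/-- The semi-inner product `(x*, y*) ↦ ⟨F x*, y*⟩`. -/
@[reducible] def core : PreInnerProductSpace.Core ℝ (PreRKHS F) where
  inner x y := (mk F).symm y (F.op ((mk F).symm x))
  conj_inner_symm x y := by simpa using F.symm' _ _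
  re_inner_nonneg x := by simpa using F.nonneg' _
  add_left x y z := by simp
  smul_left x y r := by simp

instance : SeminormedAddCommGroup (PreRKHS F) :=
  InnerProductSpace.Core.toSeminormedAddCommGroup (c := core F)

instance : InnerProductSpace ℝ (PreRKHS F) := InnerProductSpace.ofCore (core F)

theorem inner_mk (x y : StrongDual ℝ X) : inner ℝ (mk F x) (mk F y) = y (F.op x) := rfl

theorem norm_mk_le (x : StrongDual ℝ X) : ‖mk F x‖ ≤ √‖F.op‖ * ‖x‖ := by
  have h : ‖mk F x‖ ^ 2 ≤ (√‖F.op‖ * ‖x‖) ^ 2 := by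
    rw [← real_inner_self_eq_norm_sq, inner_mk, mul_pow, Real.sq_sqrt (norm_nonneg F.op)]
    calc x (F.op x) ≤ ‖x (F.op x)‖ := Real.le_norm_self _
      _ ≤ ‖x‖ * ‖F.op x‖ := x.le_opNorm _
      _ ≤ ‖x‖ * (‖F.op‖ * ‖x‖) := by gcongr; exact F.op.le_opNorm _
      _ = ‖F.op‖ * ‖x‖ ^ 2 := by ring
  exact le_of_sq_le_sq h (by positivity)

theorem norm_op_le (x : PreRKHS F) : ‖F.op ((mk F).symm x)‖ ≤ √‖F.op‖ * ‖x‖ := by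
  refine NormedSpace.norm_le_dual_bound ℝ _ (by positivity) fun y => ?_
  have h : y (F.op ((mk F).symm x)) = inner ℝ x (mk F y) := rfl
  rw [h]
  calc ‖inner ℝ x (mk F y)‖ ≤ ‖x‖ * ‖mk F y‖ := norm_inner_le_norm _ _
    _ ≤ ‖x‖ * (√‖F.op‖ * ‖y‖) := by gcongr; exact norm_mk_le F y
    _ = √‖F.op‖ * ‖x‖ * ‖y‖ := by ring

/-- The map `x* ↦ F x*`, continuous for the seminorm `⟨F x*, x*⟩ ^ (1/2)`. -/
def toX : PreRKHS F →L[ℝ] X :=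
  (F.op.toLinearMap ∘ₗ (mk F).symm.toLinearMap).mkContinuous (√‖F.op‖) (norm_op_le F)

end PreRKHS

/-- The reproducing kernel Hilbert space of `F`: the completion of `F X*` for the norm coming from
`[F x*, F y*] = ⟨F x*, y*⟩`. -/
abbrev RKHilbert (F : CovOp X) : Type _ := UniformSpace.Completion (PreRKHS F)

namespace RKHilbert

variable (F : CovOp X)

/-- The operator `i* : X* → RKHilbert F`, which sends `x*` to the class of `F x*`. -/
def adj : StrongDual ℝ X →L[ℝ] RKHilbert F :=
  (UniformSpace.Completion.toComplL (𝕜 := ℝ) (E := PreRKHS F)).comp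
    ((PreRKHS.mk F).toLinearMap.mkContinuous (√‖F.op‖) (PreRKHS.norm_mk_le F))

variable [CompleteSpace X]

/-- The injection `i : RKHilbert F → X`, the continuous extension of the inclusion `F X* ⊆ X`. -/
def incl : RKHilbert F →L[ℝ] X :=
  (PreRKHS.toX F).extend (UniformSpace.Completion.toComplL (𝕜 := ℝ) (E := PreRKHS F))

theorem incl_adj (x : StrongDual ℝ X) : incl F (adj F x) = F.op x :=
  ContinuousLinearMap.extend_eq _ UniformSpace.Completion.denseRange_coe
    (UniformSpace.Completion.isUniformInducing_coe _) (PreRKHS.mk F x)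

/-- `i` and `i*` are adjoint to each other: `[h, i* x*] = ⟨i h, x*⟩`. -/
theorem inner_adj (h : RKHilbert F) (y : StrongDual ℝ X) :
    inner ℝ h (adj F y) = y (incl F h) := by
  induction h using UniformSpace.Completion.induction_on with
  | hp => exact isClosed_eq (by fun_prop) (by fun_prop)
  | ih a =>
    have h1 : incl F (a : RKHilbert F) = F.op ((PreRKHS.mk F).symm a) :=
      incl_adj F ((PreRKHS.mk F).symm a)
    rw [h1]
    exact UniformSpace.Completion.inner_coe a (PreRKHS.mk F y)

end RKHilbert

end RKHilbert

/-! ### Hilbert–Schmidt multilinear forms -/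

section HilbertSchmidt

variable (H : Type*) [NormedAddCommGroup H] [InnerProductSpace ℝ H] [CompleteSpace H]

/-- The index set of a chosen orthonormal basis of `H`. -/
def hsIndex : Set H := (exists_hilbertBasis ℝ H).choose

/-- A chosen orthonormal basis of `H`. -/
def hsBasis : HilbertBasis (hsIndex H) ℝ H := (exists_hilbertBasis ℝ H).choose_spec.choose

variable (j : ℕ)

/-- The coefficients of a `j`-linear form with respect to the chosen orthonormal basis. -/
def hsCoeff (M : ContinuousMultilinearMap ℝ (fun _ : Fin j => H) ℝ) (a : Fin j → hsIndex H) : ℝ :=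
  M fun i => hsBasis H (a i)

/-- The Hilbert–Schmidt `j`-linear forms `M` on `H`: those whose Hilbert–Schmidt norm
`(∑_{a₁, …, aⱼ} M(v_{a₁}, …, v_{aⱼ})²) ^ (1/2)` is finite. As is well known, neither this space nor
this norm depends on the choice of the orthonormal basis `v`. -/
def hsSubmodule : Submodule ℝ (ContinuousMultilinearMap ℝ (fun _ : Fin j => H) ℝ) where
  carrier := {M | Memℓp (E := fun _ => ℝ) (hsCoeff H j M) 2}
  zero_mem' := zero_memℓp (E := fun _ : Fin j → hsIndex H => ℝ)
  add_mem' hM hN := Memℓp.add (E := fun _ : Fin j → hsIndex H => ℝ) hM hN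
  smul_mem' c _ hM := Memℓp.const_smul (E := fun _ : Fin j → hsIndex H => ℝ) hM c

/-- The space of Hilbert–Schmidt `j`-linear forms on `H`, with the Hilbert–Schmidt norm. For `j = 1`
it is `H* = H`, and for `j = 2` it is the space of Hilbert–Schmidt operators on `H`, an operator `T`
being identified with the bilinear form `(h, h') ↦ [T h, h']`. -/
def HSForm : Type _ := hsSubmodule H j

namespace HSForm

instance : AddCommGroup (HSForm H j) := inferInstanceAs (AddCommGroup (hsSubmodule H j))

instance : Module ℝ (HSForm H j) := inferInstanceAs (Module ℝ (hsSubmodule H j))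

/-- The Hilbert–Schmidt form given by a multilinear form of finite Hilbert–Schmidt norm. -/
def mk (M : ContinuousMultilinearMap ℝ (fun _ : Fin j => H) ℝ) (hM : Memℓp (E := fun _ => ℝ) (hsCoeff H j M) 2) :
    HSForm H j := ⟨M, hM⟩

/-- The family of coefficients, as an element of `ℓ²`. -/
def coeffs : HSForm H j →ₗ[ℝ] lp (fun _ : Fin j → hsIndex H => ℝ) 2 where
  toFun M := ⟨hsCoeff H j M.1, M.2⟩
  map_add' _ _ := rfl
  map_smul' _ _ := rfl

theorem coeffs_injective : Function.Injective (coeffs H j) := by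
  rw [← LinearMap.ker_eq_bot, LinearMap.ker_eq_bot']
  intro M hM
  have h0 : ∀ a : Fin j → hsIndex H, M.1 (fun i => hsBasis H (a i)) = 0 := fun a =>
    congrFun (congrArg Subtype.val hM) a
  have key : ∀ s : Finset (Fin j), ∀ v : Fin j → H,
      (∀ i, i ∉ s → v i ∈ Set.range (hsBasis H)) → M.1 v = 0 := by
    intro s
    induction s using Finset.induction_on with
    | empty =>
      intro v hv
      choose a ha using fun i => hv i (Finset.notMem_empty i)
      rw [← h0 a]
      exact congrArg M.1 (funext fun i => (ha i).symm)
    | insert i₀ s _ ih =>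
      intro v hv
      have hL : M.1.toContinuousLinearMap v i₀ = 0 := by
        refine ContinuousLinearMap.ext_on (s := Set.range (hsBasis H)) ?_ ?_
        · rw [dense_iff_closure_eq, ← Submodule.topologicalClosure_coe, (hsBasis H).dense_span]
          rfl
        · rintro _ ⟨a, rfl⟩
          refine ih (Function.update v i₀ (hsBasis H a)) fun i hi => ?_
          by_cases h : i = i₀
          · subst h; simp
          · rw [Function.update_of_ne h]
            exact hv i (by simp [h, hi])
      have := congrArg (fun L => L (v i₀)) hL
      simpa [ContinuousMultilinearMap.toContinuousLinearMap] using this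
  exact Subtype.ext (ContinuousMultilinearMap.ext fun v =>
    key Finset.univ v fun i hi => absurd (Finset.mem_univ i) hi)

instance : NormedAddCommGroup (HSForm H j) :=
  NormedAddCommGroup.induced _ _ (coeffs H j) (coeffs_injective H j)

instance : NormedSpace ℝ (HSForm H j) := NormedSpace.induced ℝ _ _ (coeffs H j)

end HSForm

end HilbertSchmidt

/-! ### Cylindrical functions and their derivatives along `H` -/

section Cylindrical

/-- `C_b^k(ℝⁿ)`: functions with continuous and bounded derivatives up to order `k`. -/
def IsCb (k n : ℕ) (φ : (Fin n → ℝ) → ℝ) : Prop :=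
  ContDiff ℝ k φ ∧ ∀ j ≤ k, ∃ C : ℝ, ∀ ξ, ‖iteratedFDeriv ℝ j φ ξ‖ ≤ C

variable {X : Type*} [NormedAddCommGroup X] [NormedSpace ℝ X]

/-- `FC_b^k(X)`: the functions `x ↦ φ(⟨x, x₁*⟩, …, ⟨x, xₙ*⟩)` with `φ ∈ C_b^k(ℝⁿ)` and
`x₁*, …, xₙ* ∈ X*`. -/
def FCb (X : Type*) [NormedAddCommGroup X] [NormedSpace ℝ X] (k : ℕ) : Set (X → ℝ) :=
  {u | ∃ (n : ℕ) (φ : (Fin n → ℝ) → ℝ) (x : Fin n → StrongDual ℝ X),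
    IsCb k n φ ∧ ∀ z, u z = φ fun i => x i z}

/-- `FC_{b,Θ}^k(X)`: the functions `x ↦ φ(⟨x, f₁*⟩, …, ⟨x, fₘ*⟩)` with `φ ∈ C_b^k(ℝᵐ)`, for a
sequence `f₁*, f₂*, …` of `N ∈ ℕ ∪ {∞}` elements of `X*` (indexed from `0`; the values `f n` with
`n ≥ N` play no role). -/
def FCbTheta (N : ℕ∞) (f : ℕ → StrongDual ℝ X) (k : ℕ) : Set (X → ℝ) :=
  {u | ∃ (m : ℕ) (φ : (Fin m → ℝ) → ℝ), (m : ℕ∞) ≤ N ∧ IsCb k m φ ∧ ∀ z, u z = φ fun i => f i z}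

theorem FCbTheta_subset (N : ℕ∞) (f : ℕ → StrongDual ℝ X) (k : ℕ) : FCbTheta N f k ⊆ FCb X k := by
  rintro u ⟨m, φ, -, hφ, hu⟩
  exact ⟨m, φ, fun i => f i, hφ, hu⟩

variable [CompleteSpace X]

/-- The `j`-th derivative along `H`, as a `j`-linear form on `H`:
`D_H^j u(z)(h₁, …, hⱼ) = D^j u(z)(i h₁, …, i hⱼ)`. As `⟨i h, x*⟩ = [i* x*, h]_H`, for
`u = φ(⟨·, x₁*⟩, …, ⟨·, xₙ*⟩)` it is
`∑ ∂_{l₁} ⋯ ∂_{lⱼ} φ(⟨z, x₁*⟩, …, ⟨z, xₙ*⟩) i* x_{l₁}* ⊗ ⋯ ⊗ i* x_{lⱼ}*`. -/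
def HDerivForm (Q : CovOp X) (j : ℕ) (u : X → ℝ) (z : X) :
    ContinuousMultilinearMap ℝ (fun _ : Fin j => RKHilbert Q) ℝ :=
  (iteratedFDeriv ℝ j u z).compContinuousLinearMap fun _ => RKHilbert.incl Q

theorem summable_prod_pi {ι : Type*} (c : ι → ℝ) (hc : ∀ a, 0 ≤ c a) (hs : Summable c) (j : ℕ) :
    Summable fun a : Fin j → ι => ∏ i, c (a i) := by
  classical
  refine summable_of_sum_le (c := ∏ _i : Fin j, ∑' a, c a)
    (fun a => Finset.prod_nonneg fun i _ => hc _) fun s => ?_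
  calc ∑ a ∈ s, ∏ i, c (a i)
      ≤ ∑ a ∈ Fintype.piFinset fun i => s.image fun a => a i, ∏ i, c (a i) := by
        refine Finset.sum_le_sum_of_subset_of_nonneg (fun a ha => ?_)
          fun a _ _ => Finset.prod_nonneg fun i _ => hc _
        exact Fintype.mem_piFinset.2 fun i => Finset.mem_image_of_mem (fun a => a i) ha
    _ = ∏ i : Fin j, ∑ b ∈ s.image fun a => a i, c b := (Finset.prod_univ_sum _ _).symm
    _ ≤ ∏ _i : Fin j, ∑' a, c a :=
        Finset.prod_le_prod (fun i _ => Finset.sum_nonneg fun b _ => hc b)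
          fun i _ => hs.sum_le_tsum _ fun b _ => hc b

/-- A form that factors through finitely many functionals of `X*` is Hilbert–Schmidt on `H`. -/
theorem memlp_hsCoeff_comp (Q : CovOp X) {n : ℕ} (x : Fin n → StrongDual ℝ X) (j : ℕ)
    (B : ContinuousMultilinearMap ℝ (fun _ : Fin j => (Fin n → ℝ)) ℝ) :
    Memℓp (E := fun _ => ℝ) (hsCoeff (RKHilbert Q) j (B.compContinuousLinearMap fun _ =>
      (ContinuousLinearMap.pi x).comp (RKHilbert.incl Q))) 2 := by
  set v := hsBasis (RKHilbert Q)
  let c : hsIndex (RKHilbert Q) → ℝ := fun a => ∑ l, (x l (RKHilbert.incl Q (v a))) ^ 2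
  have hc : Summable c := by
    refine summable_sum fun l _ => ?_
    have := v.summable_inner_mul_inner (RKHilbert.adj Q (x l)) (RKHilbert.adj Q (x l))
    refine this.congr fun a => ?_
    rw [real_inner_comm, RKHilbert.inner_adj, sq]
  refine memℓp_gen ?_
  have hp := (summable_prod_pi c (fun a => Finset.sum_nonneg fun l _ => sq_nonneg _) hc j).mul_left
    (‖B‖ ^ 2)
  refine Summable.of_nonneg_of_le (fun a => by positivity) (fun a => ?_) hp
  have hB := B.le_opNorm fun i => fun l => x l (RKHilbert.incl Q (v (a i)))
  have hn : ∀ i, ‖fun l => x l (RKHilbert.incl Q (v (a i)))‖ ^ 2 ≤ c (a i) := fun i => by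
    have : ‖fun l => x l (RKHilbert.incl Q (v (a i)))‖ ≤ √(c (a i)) := by
      refine (pi_norm_le_iff_of_nonneg (Real.sqrt_nonneg _)).2 fun l => ?_
      refine Real.le_sqrt_of_sq_le ?_
      rw [Real.norm_eq_abs, sq_abs]
      exact Finset.single_le_sum (f := fun l => (x l (RKHilbert.incl Q (v (a i)))) ^ 2)
        (fun l _ => sq_nonneg _) (Finset.mem_univ l)
    calc _ ≤ √(c (a i)) ^ 2 := by gcongr
      _ = c (a i) := Real.sq_sqrt (Finset.sum_nonneg fun l _ => sq_nonneg _)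
  have h2 : ((2 : ℝ≥0∞).toReal) = ((2 : ℕ) : ℝ) := by norm_num
  rw [h2, Real.rpow_natCast]
  calc ‖hsCoeff (RKHilbert Q) j (B.compContinuousLinearMap fun _ =>
        (ContinuousLinearMap.pi x).comp (RKHilbert.incl Q)) a‖ ^ 2
      ≤ (‖B‖ * ∏ i, ‖fun l => x l (RKHilbert.incl Q (v (a i)))‖) ^ 2 :=
        pow_le_pow_left₀ (norm_nonneg _) hB 2
    _ = ‖B‖ ^ 2 * ∏ i, ‖fun l => x l (RKHilbert.incl Q (v (a i)))‖ ^ 2 := by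
        rw [mul_pow, Finset.prod_pow]
    _ ≤ ‖B‖ ^ 2 * ∏ i, c (a i) := by
        gcongr with i
        exact hn i

/-- Composition with finitely many functionals of `X*`, as a map into Hilbert–Schmidt forms. -/
def hsComp (Q : CovOp X) {n : ℕ} (x : Fin n → StrongDual ℝ X) (j : ℕ) :
    ContinuousMultilinearMap ℝ (fun _ : Fin j => (Fin n → ℝ)) ℝ →ₗ[ℝ] HSForm (RKHilbert Q) j where
  toFun B := HSForm.mk _ j _ (memlp_hsCoeff_comp Q x j B)
  map_add' _ _ := rfl
  map_smul' _ _ := rfl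

theorem hsComp_continuous (Q : CovOp X) {n : ℕ} (x : Fin n → StrongDual ℝ X) (j : ℕ) :
    Continuous (hsComp Q x j) := by
  have : FiniteDimensional ℝ (ContinuousMultilinearMap ℝ (fun _ : Fin j => (Fin n → ℝ)) ℝ) :=
    Module.Finite.of_injective
      ({ toFun := fun B => B.toMultilinearMap
         map_add' := fun _ _ => rfl
         map_smul' := fun _ _ => rfl } :
        ContinuousMultilinearMap ℝ (fun _ : Fin j => (Fin n → ℝ)) ℝ →ₗ[ℝ]
          MultilinearMap ℝ (fun _ : Fin j => (Fin n → ℝ)) ℝ)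
      ContinuousMultilinearMap.toMultilinearMap_injective
  exact LinearMap.continuous_of_finiteDimensional _

theorem HDerivForm_eq (Q : CovOp X) {k n j : ℕ} (hj : j ≤ k) {φ : (Fin n → ℝ) → ℝ}
    (hφ : IsCb k n φ) (x : Fin n → StrongDual ℝ X) {u : X → ℝ} (hu : ∀ z, u z = φ fun i => x i z)
    (z : X) : HDerivForm Q j u z =
      (iteratedFDeriv ℝ j φ (ContinuousLinearMap.pi x z)).compContinuousLinearMap fun _ =>
        (ContinuousLinearMap.pi x).comp (RKHilbert.incl Q) := by
  have h : u = φ ∘ ContinuousLinearMap.pi x := funext fun z => hu z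
  rw [HDerivForm, h, (ContinuousLinearMap.pi x).iteratedFDeriv_comp_right hφ.1 z
    (by exact_mod_cast hj)]
  rfl

theorem memlp_HDerivForm (Q : CovOp X) {k j : ℕ} (hj : j ≤ k) {u : X → ℝ} (hu : u ∈ FCb X k)
    (z : X) : Memℓp (E := fun _ => ℝ) (hsCoeff (RKHilbert Q) j (HDerivForm Q j u z)) 2 := by
  obtain ⟨n, φ, x, hφ, hux⟩ := hu
  rw [HDerivForm_eq Q hj hφ x hux]
  exact memlp_hsCoeff_comp Q x j _

/-- The derivative `D_H^j u` of a cylindrical function, with values in the Hilbert–Schmidt forms. -/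
def HDeriv (Q : CovOp X) {k j : ℕ} (hj : j ≤ k) {u : X → ℝ} (hu : u ∈ FCb X k) (z : X) :
    HSForm (RKHilbert Q) j :=
  HSForm.mk _ j (HDerivForm Q j u z) (memlp_HDerivForm Q hj hu z)

variable [MeasurableSpace X] [BorelSpace X] [SecondCountableTopology X]

theorem memLp_FCb (μ : Measure X) [IsFiniteMeasure μ] (p : ℝ≥0∞) {k : ℕ} {u : X → ℝ}
    (hu : u ∈ FCb X k) : MemLp u p μ := by
  obtain ⟨n, φ, x, hφ, hux⟩ := hu
  have h : u = φ ∘ ContinuousLinearMap.pi x := funext fun z => hux z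
  obtain ⟨C, hC⟩ := hφ.2 0 (Nat.zero_le k)
  refine MemLp.of_bound (C := C) ?_ (ae_of_all _ fun z => ?_)
  · rw [h]
    exact (hφ.1.continuous.comp (ContinuousLinearMap.pi x).continuous).aestronglyMeasurable
  · have := hC fun i => x i z
    rwa [norm_iteratedFDeriv_zero, ← hux z] at this

theorem memLp_HDeriv (Q : CovOp X) (μ : Measure X) [IsFiniteMeasure μ] (p : ℝ≥0∞) {k j : ℕ}
    (hj : j ≤ k) {u : X → ℝ} (hu : u ∈ FCb X k) : MemLp (HDeriv Q hj hu) p μ := by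
  obtain ⟨n, φ, x, hφ, hux⟩ := id hu
  have h : HDeriv Q hj hu =
      hsComp Q x j ∘ iteratedFDeriv ℝ j φ ∘ ContinuousLinearMap.pi x :=
    funext fun z => Subtype.ext (HDerivForm_eq Q hj hφ x hux z)
  obtain ⟨C, hC⟩ := hφ.2 j hj
  let L : _ →L[ℝ] HSForm (RKHilbert Q) j := ⟨hsComp Q x j, hsComp_continuous Q x j⟩
  refine MemLp.of_bound (C := ‖L‖ * C) ?_ (ae_of_all _ fun z => ?_)
  · rw [h]
    have h1 : Continuous (iteratedFDeriv ℝ j φ) :=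
      hφ.1.continuous_iteratedFDeriv (by exact_mod_cast hj)
    exact ((hsComp_continuous Q x j).comp
      (h1.comp (ContinuousLinearMap.pi x).continuous)).aestronglyMeasurable
  · rw [h]
    exact (L.le_opNorm _).trans (mul_le_mul_of_nonneg_left (hC _) (norm_nonneg _))

/-! ### The Sobolev spaces along `H` -/

/-- `L^p(X, μ) × ∏_{1 ≤ j ≤ k} L^p(X, μ; H_j)`, where `H_j` are the Hilbert–Schmidt `j`-linear forms
on `H`, with the norm `(‖u‖^p + ∑_j ‖G_j‖^p) ^ (1/p)`. -/
abbrev SobolevAmbient (Q : CovOp X) (μ : Measure X) (p : ℝ≥0∞) (k : ℕ) : Type _ :=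
  WithLp p (Lp ℝ p μ × PiLp p fun j : Fin k => Lp (HSForm (RKHilbert Q) (j + 1)) p μ)

/-- The point `(u, D_H u, …, D_H^k u)` of the graph of `(D_H, …, D_H^k)`, for `u ∈ FC_b^k(X)`. -/
def sobolevJet (Q : CovOp X) (μ : Measure X) [IsFiniteMeasure μ] (p : ℝ≥0∞) {k : ℕ} {u : X → ℝ}
    (hu : u ∈ FCb X k) : SobolevAmbient Q μ p k :=
  WithLp.toLp p ((memLp_FCb μ p hu).toLp u,
    WithLp.toLp p fun j : Fin k => (memLp_HDeriv Q μ p (Nat.succ_le_of_lt j.2) hu).toLp _)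

/-- The Sobolev space `W^{k,p}_H(X, μ)`: the domain of the closure in `L^p(X, μ)` of the operator
`(D_H, …, D_H^k) : FC_b^k(X) → ∏_{1 ≤ j ≤ k} L^p(X, μ; H_j)`, with the graph norm. A function `u` of
the domain is recorded together with its derivatives as the point `(u, D_H u, …, D_H^k u)` of the
graph of the closure, that is, of the closure of the graph. -/
def SobolevH (Q : CovOp X) (μ : Measure X) [IsFiniteMeasure μ] (p : ℝ≥0∞) [Fact (1 ≤ p)] (k : ℕ) :
    Set (SobolevAmbient Q μ p k) :=
  closure {w | ∃ (u : X → ℝ) (hu : u ∈ FCb X k), w = sobolevJet Q μ p hu}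

end Cylindrical

/-! ### Semigroups, generators, and the hypotheses -/

section Hypotheses

variable {X : Type*} [NormedAddCommGroup X] [NormedSpace ℝ X]

/-- `T t = e^{tA}`, `t ≥ 0`, is a strongly continuous contraction semigroup on `X`. -/
structure IsContractionSemigroup (T : ℝ≥0 → X →L[ℝ] X) : Prop where
  zero : T 0 = ContinuousLinearMap.id ℝ X
  add : ∀ s t, T (s + t) = (T s).comp (T t)
  cont : ∀ x, Continuous fun t => T t x
  contraction : ∀ t, ‖T t‖ ≤ 1

/-- `x ∈ D(A)` and `A x = y`, for the infinitesimal generator `A` of the semigroup `T`. -/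
def IsGenerator (T : ℝ≥0 → X →L[ℝ] X) (x y : X) : Prop :=
  Tendsto (fun t : ℝ≥0 => (t : ℝ)⁻¹ • (T t x - x)) (𝓝[>] 0) (𝓝 y)

/-- `x* ∈ D(A*)` and `A* x* = y*`, for the adjoint `A*` of the generator `A` of `T`
(`y*` is unique, as `D(A)` is dense). -/
def IsAdjointGenerator (T : ℝ≥0 → X →L[ℝ] X) (x' y' : StrongDual ℝ X) : Prop :=
  ∀ x y, IsGenerator T x y → x' y = y' x

/-- `Q_t x* = ∫_0^t e^{sA} Q e^{sA*} x* ds`. -/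
def Qt (T : ℝ≥0 → X →L[ℝ] X) (Q : CovOp X) (t : ℝ) (x' : StrongDual ℝ X) : X :=
  ∫ s in (0 : ℝ)..t, T s.toNNReal (Q.op (x'.comp (T s.toNNReal)))

variable [MeasurableSpace X]

/-- `μ` is a centred Gaussian measure on `X` with covariance operator `C`. -/
structure IsCentredGaussianWithCov (μ : Measure X) (C : StrongDual ℝ X → X) : Prop where
  gaussian : IsGaussian μ
  mean : ∀ x' : StrongDual ℝ X, ∫ z, x' z ∂μ = 0
  cov : ∀ x' y' : StrongDual ℝ X, ∫ z, x' z * y' z ∂μ = y' (C x')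

/-- The covariance conditions: `Q_t` is, for `t > 0`, the covariance operator of a centred Gaussian
measure, and `Q_t x*` converges weakly to `Q_∞ x*` as `t → ∞`, where `Q_∞` is the covariance
operator of the centred, non-degenerate Gaussian measure `μ`. -/
structure IsInvariantSetting (T : ℝ≥0 → X →L[ℝ] X) (Q Qinf : CovOp X) (μ : Measure X) : Prop where
  exists_gaussian : ∀ t : ℝ, 0 < t → ∃ ν : Measure X, IsCentredGaussianWithCov ν (Qt T Q t)
  tendsto : ∀ x' y' : StrongDual ℝ X,
    Tendsto (fun t => y' (Qt T Q t x')) atTop (𝓝 (y' (Qinf.op x')))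
  gaussian : IsCentredGaussianWithCov μ Qinf.op
  nondegenerate : ∀ x' : StrongDual ℝ X, Qinf.op x' = 0 → x' = 0

variable [CompleteSpace X]

/-- There is `c > 0` such that, for all `x* ∈ D(A*)`, `i_∞* A* x*` belongs to `H` (as a vector of
`X`) and `|i_∞* A* x*|_H ≤ c |i* x*|_H`. -/
def AnalyticityCondition (T : ℝ≥0 → X →L[ℝ] X) (Q Qinf : CovOp X) : Prop :=
  ∃ c : ℝ, 0 < c ∧ ∀ x' y' : StrongDual ℝ X, IsAdjointGenerator T x' y' →
    ∃ h : RKHilbert Q, RKHilbert.incl Q h = RKHilbert.incl Qinf (RKHilbert.adj Qinf y') ∧ ‖h‖ ≤ c * ‖RKHilbert.adj Q x'‖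

/-- `Θ = {e_n}` is a special orthonormal basis of `H_∞` with associated sequence `f_n*`: one has
`f_n* ∈ D(A*)` and `e_n = i_∞* f_n*`, the `f_n*` are linearly independent, and there is a weak-star
dense sequence `g_n*` in `X*` each of whose elements is in the span of some `f_1*, …, f_m*`.
The basis has `N ∈ ℕ ∪ {∞}` elements (`N = ∞` if `X` has infinite dimension); indices start at `0`,
and the values `f n` with `n ≥ N` play no role. -/
structure IsSpecialBasis (T : ℝ≥0 → X →L[ℝ] X) (Qinf : CovOp X) (N : ℕ∞)
    (e : HilbertBasis {n : ℕ // (n : ℕ∞) < N} ℝ (RKHilbert Qinf)) (f : ℕ → StrongDual ℝ X) : Prop where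
  mem_domain : ∀ n : {n : ℕ // (n : ℕ∞) < N}, ∃ y', IsAdjointGenerator T (f n) y'
  eq_adj : ∀ n : {n : ℕ // (n : ℕ∞) < N}, e n = RKHilbert.adj Qinf (f n)
  linearIndependent : LinearIndependent ℝ fun n : {n : ℕ // (n : ℕ∞) < N} => f n
  exists_dense : ∃ g : ℕ → StrongDual ℝ X,
    Dense (Set.range fun n => StrongDual.toWeakDual (g n)) ∧
    ∀ n, ∃ m : ℕ, (m : ℕ∞) ≤ N ∧ g n ∈ Submodule.span ℝ (f '' Set.Iio m)

end Hypotheses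

end

/-! ### Elementary tensors as Hilbert–Schmidt forms -/

/-! Let $u=\varphi(x_1^*,\dots,x_n^*)$ be cylindrical. The idea is to keep $\varphi$ and move only
the functionals, replacing each $x_l^*$ by elements of the span $S$ of the $f_i^*$. The jet of $u$
depends on the $x_l^*$ in two ways: through the vectors $i^*x_l^*\in H$, from which the tensors in
$D_H^ju$ are built, and through the random variables $z\mapsto x_l^*(z)$, at which $\varphi$ and its
derivatives are evaluated. The $L^2(\mu_\infty)$ norm of $x^*$ is $|i_\infty^*x^*|$
(`eLpNorm_dual_eq`). So it suffices to approximate $i^*x_l^*$ and $i_\infty^*x_l^*$ in norm by one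
and the same sequence from $S$.

This is `exists_adj_sub_lt`. The map $x^*\mapsto(i^*x^*,i_\infty^*x^*)\in H\times H_\infty$ is
continuous from the weak-star to the weak topology, because pairing it with $(h,h')$ gives
$x^*(ih+i_\infty h')$. Hence the image of the weak-star dense $S$ is weakly dense in the range, and
for a subspace the weak and norm closures agree. No weak-star convergent sequence is needed.

Along a subsequence the random variables converge almost everywhere. Since the derivatives of
$\varphi$ are continuous and bounded, and $h_1\otimes\cdots\otimes h_j$ is continuous in the $h_i$
for the Hilbert–Schmidt norm (`hsTensor`), the jets converge almost everywhere with uniform bounds,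
hence in $L^p$ (`tendsto_sobolevJet`). -/

/-- A finite set of multi-indices lies in a box, over which the sum of products factors. With
squared coefficients this bounds the Hilbert–Schmidt norm of an elementary tensor. -/
theorem sum_prod_le_prod_tsum {ι : Type*} {j : ℕ} (c : Fin j → ι → ℝ) (hc : ∀ i a, 0 ≤ c i a)
    (hs : ∀ i, Summable (c i)) (s : Finset (Fin j → ι)) :
    ∑ a ∈ s, ∏ i, c i (a i) ≤ ∏ i, ∑' a, c i a := by
  classical
  calc ∑ a ∈ s, ∏ i, c i (a i)
      ≤ ∑ a ∈ Fintype.piFinset fun i => s.image fun a => a i, ∏ i, c i (a i) := by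
        refine Finset.sum_le_sum_of_subset_of_nonneg (fun a ha => ?_)
          fun a _ _ => Finset.prod_nonneg fun i _ => hc _ _
        exact Fintype.mem_piFinset.2 fun i => Finset.mem_image_of_mem (fun a => a i) ha
    _ = ∏ i : Fin j, ∑ b ∈ s.image fun a => a i, c i b := (Finset.prod_univ_sum _ _).symm
    _ ≤ ∏ i : Fin j, ∑' a, c i a :=
        Finset.prod_le_prod (fun i _ => Finset.sum_nonneg fun b _ => hc _ b)
          fun i _ => (hs i).sum_le_tsum _ fun b _ => hc i b

section HSTensor

variable (H : Type*) [NormedAddCommGroup H] [InnerProductSpace ℝ H] (j : ℕ)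

/-- The form `(v₁, …, vⱼ) ↦ ∏ [hᵢ, vᵢ]`. -/
noncomputable def hsTensorForm (h : Fin j → H) :
    ContinuousMultilinearMap ℝ (fun _ : Fin j => H) ℝ :=
  (ContinuousMultilinearMap.mkPiAlgebra ℝ (Fin j) ℝ).compContinuousLinearMap fun i =>
    innerSL ℝ (h i)

theorem hsTensorForm_apply (h v : Fin j → H) :
    hsTensorForm H j h v = ∏ i, inner ℝ (h i) (v i) := by
  simp [hsTensorForm]

variable [CompleteSpace H]

theorem sum_hsCoeff_hsTensorForm_le (h : Fin j → H) (s : Finset (Fin j → hsIndex H)) :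
    ∑ a ∈ s, ‖hsCoeff H j (hsTensorForm H j h) a‖ ^ (2 : ℝ≥0∞).toReal ≤ (∏ i, ‖h i‖) ^ 2 := by
  have h2 : ((2 : ℝ≥0∞).toReal) = ((2 : ℕ) : ℝ) := by norm_num
  -- Parseval's identity in each factor.
  have hsum : ∀ i, HasSum (fun a => (inner ℝ (h i) (hsBasis H a)) ^ 2) (‖h i‖ ^ 2) := fun i => by
    have := (hsBasis H).hasSum_inner_mul_inner (h i) (h i)
    rw [real_inner_self_eq_norm_sq] at this
    simpa only [real_inner_comm (h i), ← sq] using this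
  have key := sum_prod_le_prod_tsum (fun i a => (inner ℝ (h i) (hsBasis H a)) ^ 2)
    (fun _ _ => sq_nonneg _) (fun i => (hsum i).summable) s
  simp only [(hsum _).tsum_eq, Finset.prod_pow] at key
  simpa only [h2, hsCoeff, hsTensorForm_apply, Real.rpow_natCast, Real.norm_eq_abs, sq_abs,
    Finset.prod_pow] using key

theorem memlp_hsCoeff_hsTensorForm (h : Fin j → H) :
    Memℓp (E := fun _ => ℝ) (hsCoeff H j (hsTensorForm H j h)) 2 :=
  memℓp_gen' (sum_hsCoeff_hsTensorForm_le H j h)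

/-- The elementary tensor `h₁ ⊗ ⋯ ⊗ hⱼ`, as a continuous multilinear map into the Hilbert–Schmidt
forms. -/
noncomputable def hsTensor : ContinuousMultilinearMap ℝ (fun _ : Fin j => H) (HSForm H j) :=
  MultilinearMap.mkContinuous
    { toFun := fun h => HSForm.mk H j (hsTensorForm H j h) (memlp_hsCoeff_hsTensorForm H j h)
      map_update_add' := fun {inst} m i x y => by
        -- Multilinearity is required for every decidability instance on `Fin j`; it is reduced to
        -- the canonical one.
        obtain rfl : inst = instDecidableEqFin j := Subsingleton.elim _ _
        refine Subtype.ext (ContinuousMultilinearMap.ext fun v => ?_)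
        change hsTensorForm H j _ v = hsTensorForm H j _ v + hsTensorForm H j _ v
        simp only [hsTensorForm_apply]
        -- Only the factor at `i` sees the update; the product over the other indices is unchanged.
        simp only [← Finset.mul_prod_erase Finset.univ _ (Finset.mem_univ i),
          Function.update_self, inner_add_left, add_mul]
        congr 2 <;> refine Finset.prod_congr rfl fun l hl => ?_ <;>
          simp [Function.update_of_ne (Finset.ne_of_mem_erase hl)]
      map_update_smul' := fun {inst} m i c x => by
        obtain rfl : inst = instDecidableEqFin j := Subsingleton.elim _ _
        refine Subtype.ext (ContinuousMultilinearMap.ext fun v => ?_)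
        change hsTensorForm H j _ v = c • hsTensorForm H j _ v
        simp only [hsTensorForm_apply]
        simp only [← Finset.mul_prod_erase Finset.univ _ (Finset.mem_univ i),
          Function.update_self, real_inner_smul_left, smul_eq_mul, mul_assoc]
        congr 2
        refine Finset.prod_congr rfl fun l hl => ?_
        simp [Function.update_of_ne (Finset.ne_of_mem_erase hl)] }
    1 fun h => by
      rw [one_mul]
      refine lp.norm_le_of_forall_sum_le (by norm_num)
        (Finset.prod_nonneg fun i _ => norm_nonneg (h i)) fun s => ?_
      refine (sum_hsCoeff_hsTensorForm_le H j h s).trans_eq ?_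
      rw [show ((2 : ℝ≥0∞).toReal) = ((2 : ℕ) : ℝ) by norm_num, Real.rpow_natCast]

theorem HSForm.coe_finset_sum {ι : Type*} (s : Finset ι) (M : ι → HSForm H j) :
    (∑ r ∈ s, M r).1 = ∑ r ∈ s, (M r).1 :=
  map_sum (hsSubmodule H j).subtype M s

end HSTensor

/-! ### Cylindrical functions over the span of `Θ` -/

theorem IsCb.comp_clm {k n m : ℕ} {φ : (Fin n → ℝ) → ℝ} (hφ : IsCb k n φ)
    (L : (Fin m → ℝ) →L[ℝ] (Fin n → ℝ)) : IsCb k m (φ ∘ L) := by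
  refine ⟨hφ.1.comp L.contDiff, fun j hj => ?_⟩
  obtain ⟨C, hC⟩ := hφ.2 j hj
  refine ⟨C * ∏ _i : Fin j, ‖L‖, fun ξ => ?_⟩
  rw [L.iteratedFDeriv_comp_right hφ.1 ξ (by exact_mod_cast hj)]
  exact (ContinuousMultilinearMap.norm_compContinuousLinearMap_le _ _).trans
    (mul_le_mul_of_nonneg_right (hC _) (Finset.prod_nonneg fun _ _ => norm_nonneg _))

/-- Finitely many elements of the span involve only an initial segment of the $f_i^*$; the linear
change of coordinates is absorbed into $\varphi$. -/
theorem mem_FCbTheta_of_mem_span {X : Type*} [NormedAddCommGroup X] [NormedSpace ℝ X] {N : ℕ∞} {f : ℕ → StrongDual ℝ X} {k n : ℕ}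
    {φ : (Fin n → ℝ) → ℝ} (hφ : IsCb k n φ) {y : Fin n → StrongDual ℝ X}
    (hy : ∀ l, y l ∈ Submodule.span ℝ (f '' {i | (i : ℕ∞) < N})) :
    (fun z => φ fun l => y l z) ∈ FCbTheta N f k := by
  have h1 : ∀ l, ∃ m : ℕ, (m : ℕ∞) ≤ N ∧ y l ∈ Submodule.span ℝ (f '' Iio m) := fun l => by
    have hl := hy l
    generalize y l = a at hl
    induction hl using Submodule.span_induction with
    | mem _ h =>
      obtain ⟨i, hi, rfl⟩ := h
      exact ⟨i + 1, by simpa using Order.add_one_le_of_lt (show (i : ℕ∞) < N from hi),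
        Submodule.subset_span ⟨i, Nat.lt_succ_self i, rfl⟩⟩
    | zero => exact ⟨0, by simp, Submodule.zero_mem _⟩
    | add a b _ _ ha hb =>
      obtain ⟨m, hm, ha⟩ := ha
      obtain ⟨m', hm', hb⟩ := hb
      refine ⟨max m m', by rcases max_choice m m' with h | h <;> rw [h] <;> assumption,
        Submodule.add_mem _ (Submodule.span_mono ?_ ha) (Submodule.span_mono ?_ hb)⟩
      · exact image_mono (Iio_subset_Iio (le_max_left _ _))
      · exact image_mono (Iio_subset_Iio (le_max_right _ _))
    | smul c a _ ha =>
      obtain ⟨m, hm, ha⟩ := ha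
      exact ⟨m, hm, Submodule.smul_mem _ c ha⟩
  choose m hm hym using h1
  set M := Finset.univ.sup m with hM
  -- When `N` is finite the common length must not exceed it. A maximum of admissible lengths is
  -- admissible, and the empty maximum is `0`.
  have hMN : (M : ℕ∞) ≤ N := Finset.sup_induction (p := fun a : ℕ => (a : ℕ∞) ≤ N) (by simp)
    (fun a ha b hb => by rcases max_choice a b with h | h <;> rw [h] <;> assumption)
    fun l _ => hm l
  have hr : ∀ m, range (fun i : Fin m => f i) = f '' Iio m := fun m => by
    ext w
    simp only [mem_range, mem_image, mem_Iio]
    exact ⟨fun ⟨i, hi⟩ => ⟨i, i.2, hi⟩, fun ⟨i, hi, h⟩ => ⟨⟨i, hi⟩, h⟩⟩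
  have h2 : ∀ l, ∃ c : Fin M → ℝ, ∑ i, c i • f i = y l := fun l => by
    rw [← Submodule.mem_span_range_iff_exists_fun, hr]
    exact Submodule.span_mono (image_mono (Iio_subset_Iio (Finset.le_sup (Finset.mem_univ l))))
      (hym l)
  choose c hc using h2
  refine ⟨M, φ ∘ ContinuousLinearMap.pi fun l => ∑ i, c l i • ContinuousLinearMap.proj i, hMN,
    hφ.comp_clm _, fun z => congrArg φ (funext fun l => ?_)⟩
  simp [← hc l]

/-- Vitali's theorem: on a finite measure space a uniform bound gives uniform integrability. -/
theorem tendsto_Lp_of_bounded_of_ae {α E : Type*} [MeasurableSpace α] {μ : Measure α}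
    [IsFiniteMeasure μ] [NormedAddCommGroup E] {p : ℝ≥0∞} [hp1 : Fact (1 ≤ p)] (hp : p ≠ ∞)
    {g : ℕ → α → E} {h : α → E} (hg : ∀ m, MemLp (g m) p μ) (hh : MemLp h p μ) {C : ℝ}
    (hC : ∀ m a, ‖g m a‖ ≤ C) (hlim : ∀ᵐ a ∂μ, Tendsto (fun m => g m a) atTop (𝓝 (h a))) :
    Tendsto (fun m => (hg m).toLp (g m)) atTop (𝓝 (hh.toLp h)) := by
  rw [Lp.tendsto_Lp_iff_tendsto_eLpNorm'']
  refine tendsto_Lp_finite_of_tendsto_ae hp1.out hp (fun m => (hg m).1) hh ?_ hlim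
  -- The threshold `C + 1` exceeds the bound strictly, so the sets carrying the tails are empty.
  refine unifIntegrable_of hp1.out hp (fun m => (hg m).1) fun ε _ =>
    ⟨(C + 1).toNNReal, fun m => ?_⟩
  have : {a | (C + 1).toNNReal ≤ ‖g m a‖₊} = ∅ := by
    refine eq_empty_of_forall_notMem fun a ha => ?_
    have h1 : C + 1 ≤ ‖g m a‖ := (Real.le_coe_toNNReal _).trans (by exact_mod_cast ha)
    linarith [hC m a]
  simp [this]

/-! ### Continuous dependence of the derivatives on the functionals -/

section Approximation

variable {X : Type*} [NormedAddCommGroup X] [NormedSpace ℝ X] [CompleteSpace X]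

/-- Expansion of `B` in the standard basis. It separates `B` from the functionals and shows that the
latter enter only through $i^*x_l^*$, so that convergence in $H$ is enough. -/
theorem hsComp_eq_sum (Q : CovOp X) {n : ℕ} (x : Fin n → StrongDual ℝ X) (j : ℕ)
    (B : ContinuousMultilinearMap ℝ (fun _ : Fin j => (Fin n → ℝ)) ℝ) :
    hsComp Q x j B = ∑ r : Fin j → Fin n, B (fun i => Pi.single (r i) 1) •
      hsTensor (RKHilbert Q) j fun i => RKHilbert.adj Q (x (r i)) := by
  refine Subtype.ext (ContinuousMultilinearMap.ext fun v => ?_)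
  rw [HSForm.coe_finset_sum, sum_apply]
  change B (fun i => fun l => x l (RKHilbert.incl Q (v i))) =
    ∑ r : Fin j → Fin n, B (fun i => Pi.single (r i) 1) *
      hsTensorForm (RKHilbert Q) j (fun i => RKHilbert.adj Q (x (r i))) v
  have hw : (fun i => fun l => x l (RKHilbert.incl Q (v i))) =
      fun i => ∑ l, x l (RKHilbert.incl Q (v i)) • (Pi.single l 1 : Fin n → ℝ) := by
    funext i
    exact pi_eq_sum_univ' _
  rw [hw, B.map_sum]
  refine Finset.sum_congr rfl fun r _ => ?_
  rw [B.map_smul_univ (fun i => x (r i) (RKHilbert.incl Q (v i))) fun i => Pi.single (r i) 1,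
    hsTensorForm_apply, smul_eq_mul, mul_comm]
  congr 1
  refine Finset.prod_congr rfl fun i _ => ?_
  rw [real_inner_comm, RKHilbert.inner_adj]

theorem tendsto_hsComp (Q : CovOp X) {n j : ℕ} {x : Fin n → StrongDual ℝ X}
    {y : ℕ → Fin n → StrongDual ℝ X}
    (hy : ∀ l, Tendsto (fun m => RKHilbert.adj Q (y m l)) atTop (𝓝 (RKHilbert.adj Q (x l))))
    {B : ContinuousMultilinearMap ℝ (fun _ : Fin j => (Fin n → ℝ)) ℝ}
    {C : ℕ → ContinuousMultilinearMap ℝ (fun _ : Fin j => (Fin n → ℝ)) ℝ}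
    (hC : Tendsto C atTop (𝓝 B)) :
    Tendsto (fun m => hsComp Q (y m) j (C m)) atTop (𝓝 (hsComp Q x j B)) := by
  simp only [hsComp_eq_sum]
  refine tendsto_finsetSum _ fun r _ => Tendsto.smul ?_ ?_
  · exact ((ContinuousMultilinearMap.apply ℝ (fun _ : Fin j => (Fin n → ℝ)) ℝ
      fun i => Pi.single (r i) 1).continuous.tendsto B).comp hC
  · exact ((hsTensor (RKHilbert Q) j).cont.tendsto _).comp (tendsto_pi_nhds.2 fun i => hy (r i))

/-- Each of the finitely many tensor sequences converges, hence is bounded; the bounds add up. -/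
theorem exists_norm_hsComp_le (Q : CovOp X) {n : ℕ} (j : ℕ) {x : Fin n → StrongDual ℝ X}
    {y : ℕ → Fin n → StrongDual ℝ X}
    (hy : ∀ l, Tendsto (fun m => RKHilbert.adj Q (y m l)) atTop (𝓝 (RKHilbert.adj Q (x l)))) :
    ∃ K : ℝ, ∀ m (B : ContinuousMultilinearMap ℝ (fun _ : Fin j => (Fin n → ℝ)) ℝ),
      ‖hsComp Q (y m) j B‖ ≤ K * ‖B‖ := by
  have h : ∀ r : Fin j → Fin n, ∃ K : ℝ, ∀ m,
      ‖hsTensor (RKHilbert Q) j fun i => RKHilbert.adj Q (y m (r i))‖ ≤ K := fun r => by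
    have := (((hsTensor (RKHilbert Q) j).cont.tendsto _).comp
      (tendsto_pi_nhds.2 fun i => hy (r i))).norm.bddAbove_range
    obtain ⟨K, hK⟩ := this
    exact ⟨K, fun m => hK ⟨m, rfl⟩⟩
  choose K hK using h
  refine ⟨∑ r, K r, fun m B => ?_⟩
  rw [hsComp_eq_sum, Finset.sum_mul]
  refine norm_sum_le_of_le _ fun r _ => ?_
  rw [norm_smul, mul_comm]
  refine mul_le_mul (hK r m) ?_ (norm_nonneg _) ((norm_nonneg _).trans (hK r m))
  -- The standard basis vectors have sup norm `1`.
  refine (B.le_opNorm _).trans (mul_le_of_le_one_right (norm_nonneg _) ?_)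
  exact Finset.prod_le_one (fun _ _ => norm_nonneg _) fun i _ => by
    rw [Pi.norm_single, norm_one]

/-! ### Weak-star density and simultaneous approximation in two reproducing kernel spaces -/

/-- A Hahn–Banach argument in the Hilbert sum of the two spaces: a vector orthogonal to the image of
`S` defines a weak-star continuous functional vanishing on `S`, hence on all of $X^*$. Working in
the sum makes one `y` serve both spaces. -/
theorem exists_adj_sub_lt (F G : CovOp X) {S : Submodule ℝ (StrongDual ℝ X)}
    (hS : Dense (StrongDual.toWeakDual '' (S : Set (StrongDual ℝ X)))) (x : StrongDual ℝ X)
    {ε : ℝ} (hε : 0 < ε) :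
    ∃ y ∈ S, ‖RKHilbert.adj F y - RKHilbert.adj F x‖ < ε ∧
      ‖RKHilbert.adj G y - RKHilbert.adj G x‖ < ε := by
  let L : StrongDual ℝ X →ₗ[ℝ] WithLp 2 (RKHilbert F × RKHilbert G) :=
    (WithLp.linearEquiv 2 ℝ (RKHilbert F × RKHilbert G)).symm.toLinearMap ∘ₗ
      ((RKHilbert.adj F).toLinearMap.prod (RKHilbert.adj G).toLinearMap)
  have hL : ∀ v y, inner ℝ v (L y) = y (RKHilbert.incl F v.fst + RKHilbert.incl G v.snd) :=
    fun v y => by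
      rw [WithLp.prod_inner_apply, map_add, ← RKHilbert.inner_adj, ← RKHilbert.inner_adj]
      rfl
  have hmem : L x ∈ (S.map L).topologicalClosure := by
    -- The norm closure is the double orthogonal complement, so only scalar products need testing.
    rw [← Submodule.orthogonal_orthogonal_eq_closure, Submodule.mem_orthogonal]
    intro v hv
    rw [hL]
    have hcl : IsClosed {z : WeakDual ℝ X |
        z (RKHilbert.incl F v.fst + RKHilbert.incl G v.snd) = 0} :=
      isClosed_eq (WeakDual.eval_continuous _) continuous_const
    have hsub : StrongDual.toWeakDual '' (S : Set (StrongDual ℝ X)) ⊆ {z : WeakDual ℝ X |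
        z (RKHilbert.incl F v.fst + RKHilbert.incl G v.snd) = 0} := by
      rintro _ ⟨y, hy, rfl⟩
      have := (Submodule.mem_orthogonal' _ _).1 hv (L y) (Submodule.mem_map_of_mem hy)
      rwa [hL] at this
    exact hcl.closure_subset_iff.2 hsub (hS (StrongDual.toWeakDual x))
  obtain ⟨_, ⟨y, hy, rfl⟩, hd⟩ := Metric.mem_closure_iff.1 hmem ε hε
  rw [dist_comm, dist_eq_norm] at hd
  exact ⟨y, hy, (WithLp.norm_fst_le _ _).trans_lt hd, (WithLp.norm_snd_le _ _).trans_lt hd⟩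

theorem exists_seq_tendsto_adj (F G : CovOp X) {S : Submodule ℝ (StrongDual ℝ X)}
    (hS : Dense (StrongDual.toWeakDual '' (S : Set (StrongDual ℝ X)))) (x : StrongDual ℝ X) :
    ∃ y : ℕ → StrongDual ℝ X, (∀ m, y m ∈ S) ∧
      Tendsto (fun m => RKHilbert.adj F (y m)) atTop (𝓝 (RKHilbert.adj F x)) ∧
      Tendsto (fun m => RKHilbert.adj G (y m)) atTop (𝓝 (RKHilbert.adj G x)) := by
  choose y hyS hF hG using fun m : ℕ => exists_adj_sub_lt F G hS x
    (Nat.one_div_pos_of_nat (α := ℝ) (n := m))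
  refine ⟨y, hyS, ?_, ?_⟩ <;> rw [tendsto_iff_norm_sub_tendsto_zero]
  · exact squeeze_zero (fun _ => norm_nonneg _) (fun m => (hF m).le)
      tendsto_one_div_add_atTop_nhds_zero_nat
  · exact squeeze_zero (fun _ => norm_nonneg _) (fun m => (hG m).le)
      tendsto_one_div_add_atTop_nhds_zero_nat

/-! ### Convergence of the jets -/

variable [MeasurableSpace X] [BorelSpace X]

/-- Both sides squared are the variance $\langle Fx^*,x^*\rangle$ of $x^*$ under `μ`. -/
theorem eLpNorm_dual_eq {μ : Measure X} {F : CovOp X}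
    (hμ : IsCentredGaussianWithCov μ F.op) (x : StrongDual ℝ X) :
    eLpNorm x 2 μ = ENNReal.ofReal ‖RKHilbert.adj F x‖ := by
  have := hμ.gaussian
  have hm := IsGaussian.memLp_dual μ x 2 (by simp)
  rw [hm.eLpNorm_eq_integral_rpow_norm (by simp) (by simp)]
  congr 1
  have h1 : ∫ z, ‖x z‖ ^ (2 : ℝ≥0∞).toReal ∂μ = ‖RKHilbert.adj F x‖ ^ 2 := by
    rw [← real_inner_self_eq_norm_sq, RKHilbert.inner_adj, RKHilbert.incl_adj, ← hμ.cov]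
    simp [← sq]
  rw [h1]
  rw [ENNReal.toReal_ofNat, ← one_div, ← Real.sqrt_eq_rpow, Real.sqrt_sq (norm_nonneg _)]

/-- Convergence of the $i_\infty^*y_l$ is convergence in $L^2(\mu)$, hence in measure, which yields
a subsequence. It is extracted for the whole vector in $\mathbb R^n$, so it is common to all `l`. -/
theorem exists_seq_ae_tendsto_of_tendsto_adj {μ : Measure X} [IsFiniteMeasure μ] {F : CovOp X}
    (hμ : IsCentredGaussianWithCov μ F.op) {n : ℕ} {x : Fin n → StrongDual ℝ X}
    {y : ℕ → Fin n → StrongDual ℝ X}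
    (hy : ∀ l, Tendsto (fun m => RKHilbert.adj F (y m l)) atTop (𝓝 (RKHilbert.adj F (x l)))) :
    ∃ ns : ℕ → ℕ, StrictMono ns ∧ ∀ᵐ z ∂μ,
      Tendsto (fun m => ContinuousLinearMap.pi (y (ns m)) z) atTop
        (𝓝 (ContinuousLinearMap.pi x z)) := by
  refine (tendstoInMeasure_of_tendsto_eLpNorm (p := 2) (by simp)
    (fun m => (ContinuousLinearMap.pi (y m)).continuous.aestronglyMeasurable)
    (ContinuousLinearMap.pi x).continuous.aestronglyMeasurable ?_).exists_seq_tendsto_ae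
  have hlim : Tendsto (fun m => ∑ l, eLpNorm (y m l - x l : StrongDual ℝ X) 2 μ) atTop (𝓝 0) := by
    have h0 : (0 : ℝ≥0∞) = ∑ _l : Fin n, 0 := Finset.sum_const_zero.symm
    refine h0 ▸ tendsto_finsetSum _ fun l _ => ?_
    simp only [eLpNorm_dual_eq hμ, map_sub]
    rw [← ENNReal.ofReal_zero]
    exact ENNReal.tendsto_ofReal (tendsto_iff_norm_sub_tendsto_zero.1 (hy l))
  refine tendsto_of_tendsto_of_tendsto_of_le_of_le tendsto_const_nhds hlim (fun _ => zero_le)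
    fun m => ?_
  -- The sup norm on $\mathbb R^n$ is at most the sum of the absolute coordinates.
  calc eLpNorm (⇑(ContinuousLinearMap.pi (y m)) - ⇑(ContinuousLinearMap.pi x)) 2 μ
      ≤ eLpNorm (∑ l, fun z => ‖(y m l - x l) z‖) 2 μ := by
        refine eLpNorm_mono_real fun z => ?_
        rw [Finset.sum_apply]
        refine (pi_norm_le_iff_of_nonneg (Finset.sum_nonneg fun _ _ => norm_nonneg _)).2
          fun l => ?_
        exact Finset.single_le_sum (f := fun l => ‖(y m l - x l) z‖)
          (fun _ _ => norm_nonneg _) (Finset.mem_univ l)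
    _ ≤ ∑ l, eLpNorm (fun z => ‖(y m l - x l) z‖) 2 μ :=
        eLpNorm_sum_le (fun l _ => (y m l - x l).continuous.norm.aestronglyMeasurable)
          (by norm_num)
    _ = ∑ l, eLpNorm (y m l - x l : StrongDual ℝ X) 2 μ := by simp only [eLpNorm_norm]

variable [SecondCountableTopology X]

/-- Each component of the jet is a continuous bounded derivative of $\varphi$ at a point converging
almost everywhere, contracted with vectors converging in $H$. The bounds are uniform in `m` and `z`,
so `tendsto_Lp_of_bounded_of_ae` applies componentwise. -/
theorem tendsto_sobolevJet (Q : CovOp X) {μ : Measure X} [IsFiniteMeasure μ] {p : ℝ≥0∞}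
    [Fact (1 ≤ p)] (hp : p ≠ ∞) {k n : ℕ} {φ : (Fin n → ℝ) → ℝ} (hφ : IsCb k n φ)
    {x : Fin n → StrongDual ℝ X} {y : ℕ → Fin n → StrongDual ℝ X}
    (hy : ∀ l, Tendsto (fun m => RKHilbert.adj Q (y m l)) atTop (𝓝 (RKHilbert.adj Q (x l))))
    (hae : ∀ᵐ z ∂μ, Tendsto (fun m => ContinuousLinearMap.pi (y m) z) atTop
      (𝓝 (ContinuousLinearMap.pi x z)))
    {v : ℕ → X → ℝ} (hv : ∀ m, v m ∈ FCb X k) (hvy : ∀ m z, v m z = φ fun l => y m l z)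
    {u : X → ℝ} (hu : u ∈ FCb X k) (hux : ∀ z, u z = φ fun l => x l z) :
    Tendsto (fun m => sobolevJet Q μ p (hv m)) atTop (𝓝 (sobolevJet Q μ p hu)) := by
  refine ((WithLp.prod_continuous_toLp p _ _).tendsto _).comp (Tendsto.prodMk_nhds ?_ ?_)
  · obtain ⟨C, hC⟩ := hφ.2 0 (Nat.zero_le k)
    refine tendsto_Lp_of_bounded_of_ae hp _ _ (C := C) (fun m z => ?_) ?_
    · have := hC fun l => y m l z
      rwa [norm_iteratedFDeriv_zero, ← hvy m z] at this
    · filter_upwards [hae] with z hz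
      simp only [hux, hvy]
      exact (hφ.1.continuous.tendsto _).comp hz
  · refine ((PiLp.continuous_toLp p _).tendsto _).comp (tendsto_pi_nhds.2 fun j => ?_)
    have hj : (j : ℕ) + 1 ≤ k := Nat.succ_le_of_lt j.2
    obtain ⟨C, hC⟩ := hφ.2 _ hj
    obtain ⟨K, hK⟩ := exists_norm_hsComp_le Q ((j : ℕ) + 1) hy
    have heq : ∀ {w : X → ℝ} (hw : w ∈ FCb X k) (a : Fin n → StrongDual ℝ X)
        (_ : ∀ z, w z = φ fun l => a l z) (z : X), HDeriv Q hj hw z =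
        hsComp Q a _ (iteratedFDeriv ℝ ((j : ℕ) + 1) φ (ContinuousLinearMap.pi a z)) :=
      fun hw a hwa z => Subtype.ext (HDerivForm_eq Q hj hφ a hwa z)
    -- `K` carries no sign information, hence the absolute value.
    refine tendsto_Lp_of_bounded_of_ae hp _ _ (C := |K| * C) (fun m z => ?_) ?_
    · rw [heq (hv m) (y m) (hvy m)]
      exact (hK m _).trans (mul_le_mul (le_abs_self K) (hC _) (norm_nonneg _) (abs_nonneg K))
    · filter_upwards [hae] with z hz
      rw [heq hu x hux]
      simp only [heq (hv _) (y _) (hvy _)]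
      exact tendsto_hsComp Q hy
        (((hφ.1.continuous_iteratedFDeriv (by exact_mod_cast hj)).tendsto _).comp hz)

end Approximation

/-! ### Density -/

theorem IsSpecialBasis.dense_span {X : Type*} [NormedAddCommGroup X] [NormedSpace ℝ X]
    [CompleteSpace X] {T : ℝ≥0 → X →L[ℝ] X} {Qinf : CovOp X} {N : ℕ∞}
    {e : HilbertBasis {n : ℕ // (n : ℕ∞) < N} ℝ (RKHilbert Qinf)} {f : ℕ → StrongDual ℝ X}
    (hΘ : IsSpecialBasis T Qinf N e f) :
    Dense (StrongDual.toWeakDual ''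
      (Submodule.span ℝ (f '' {i | (i : ℕ∞) < N}) : Set (StrongDual ℝ X))) := by
  obtain ⟨g, hg, hgf⟩ := hΘ.exists_dense
  refine hg.mono ?_
  rintro _ ⟨n, rfl⟩
  obtain ⟨m, hm, hgm⟩ := hgf n
  refine mem_image_of_mem _ (Submodule.span_mono (image_mono fun i hi => ?_) hgm)
  exact lt_of_lt_of_le (by exact_mod_cast hi) hm

theorem proposition2p15 {X : Type*} [NormedAddCommGroup X] [NormedSpace ℝ X] [CompleteSpace X]
    [SecondCountableTopology X] [MeasurableSpace X] [BorelSpace X]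
    (T : ℝ≥0 → X →L[ℝ] X) (hT : IsContractionSemigroup T)
    (Q Qinf : CovOp X) (μ : Measure X) [IsFiniteMeasure μ]
    (hμ : IsInvariantSetting T Q Qinf μ) (hA : AnalyticityCondition T Q Qinf)
    (N : ℕ∞) (e : HilbertBasis {n : ℕ // (n : ℕ∞) < N} ℝ (RKHilbert Qinf)) (f : ℕ → StrongDual ℝ X)
    (hΘ : IsSpecialBasis T Qinf N e f)
    (k : ℕ) (p : ℝ≥0∞) [Fact (1 ≤ p)] (hp1 : 1 < p) (hp : p ≠ ∞) :
    Dense {w : SobolevH Q μ p k | ∃ (u : X → ℝ) (hu : u ∈ FCbTheta N f k),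
      (w : SobolevAmbient Q μ p k) = sobolevJet Q μ p (FCbTheta_subset N f k hu)} := by
  have hjet : ∀ (u : X → ℝ) (hu : u ∈ FCb X k), sobolevJet Q μ p hu ∈
      closure {w | ∃ (u : X → ℝ) (hu : u ∈ FCbTheta N f k),
        w = sobolevJet Q μ p (FCbTheta_subset N f k hu)} := by
    intro u hu
    obtain ⟨n, φ, x, hφ, hux⟩ := id hu
    choose y hyS hyQ hyI using fun l => exists_seq_tendsto_adj Q Qinf hΘ.dense_span (x l)
    obtain ⟨ns, hns, hae⟩ := exists_seq_ae_tendsto_of_tendsto_adj hμ.gaussian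
      (y := fun m l => y l m) hyI
    have hv : ∀ m, (fun z => φ fun l => y l (ns m) z) ∈ FCbTheta N f k := fun m =>
      mem_FCbTheta_of_mem_span hφ fun l => hyS l (ns m)
    exact mem_closure_of_tendsto
      -- Convergence in $H$ persists along the subsequence chosen for almost everywhere convergence.
      (tendsto_sobolevJet Q hp hφ (fun l => (hyQ l).comp hns.tendsto_atTop) hae
        (fun m => FCbTheta_subset N f k (hv m)) (fun _ _ => rfl) hu hux)
      (Eventually.of_forall fun m => ⟨_, hv m, rfl⟩)
  rw [Subtype.dense_iff]
  intro w hw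
  -- The Sobolev space is the closure of the jets of all cylindrical functions, so it lies in the
  -- closed set of limits of $\Theta$-jets as soon as those jets do, which is `hjet`.
  refine closure_mono (s := {w | ∃ (u : X → ℝ) (hu : u ∈ FCbTheta N f k),
    w = sobolevJet Q μ p (FCbTheta_subset N f k hu)}) ?_ (closure_minimal ?_ isClosed_closure hw)
  · rintro _ ⟨v, hv, rfl⟩
    exact ⟨⟨_, subset_closure ⟨v, FCbTheta_subset N f k hv, rfl⟩⟩, ⟨v, hv, rfl⟩, rfl⟩
  · rintro _ ⟨u, hu, rfl⟩
    exact hjet u hu
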